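/- All hypergraphs are finite and without repeated edges, and $\log=\log_2$. A hypergraph is *linear* if any two distinct edges share at most one vertex. A hypergraph has an *$r$-regular subgraph* if there is a set of its edges which covers every vertex of some nonempty vertex set exactly $r$ times and covers no other vertex. Let $f_{k,r}(n)$ be the maximum number of edges of a linear $n$-vertex $k$-uniform hypergraph with no $r$-regular subgraph. (1) For all integers $k,r\ge 3$ there is $N=N(k,r)$ such that for all $n\ge N$ $$f_{k,r}(n) < 6n^2(\log\log n)^{-\frac{1}{2(k-1)}}.$$ (2) In particular, $f_{3,3}(n)=o(n^2)$ as $n\to\infty$. (3) For all integers $2\le t<k$ and $r\ge 1$ there is $N=N(t,k,r)$ such that for every $n\ge N$ every $n$-vertex Steiner system with parameters $(t,k)$ (that is, every $k$-uniform $n$-vertex hypergraph in which each set of $t$ vertices lies in exactly one edge) contains an $r$-regular subgraph. -/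

import Mathlib

namespace Hypergraph

/-- Every edge has exactly `k` vertices. -/
def UniformOf {α : Type*} (H : Hypergraph α) (k : ℕ) : Prop :=
  ∀ e ∈ H.edgeSet, e.encard = k

/-- Two distinct edges share at most one vertex. -/
def Linear {α : Type*} (H : Hypergraph α) : Prop :=
  ∀ e ∈ H.edgeSet, ∀ f ∈ H.edgeSet, e ≠ f → (e ∩ f).encard ≤ 1

/-- There is a collection `F` of (distinct) edges of `H` which covers each vertex of some nonempty
set `S` exactly `r` times and covers no other vertex. -/
def HasRegularSubgraph {α : Type*} (H : Hypergraph α) (r : ℕ) : Prop :=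
  ∃ F ⊆ H.edgeSet, ∃ S ⊆ H.vertexSet, S.Nonempty ∧
    (∀ v ∈ S, {e ∈ F | v ∈ e}.encard = r) ∧ (∀ v ∉ S, ∀ e ∈ F, v ∉ e)

/-- A Steiner system with parameters `t`, `k`: the edges (blocks) have `k` vertices, and every set
of `t` vertices is contained in exactly one of them. -/
def IsSteinerSystem {α : Type*} (H : Hypergraph α) (t k : ℕ) : Prop :=
  H.UniformOf k ∧
    ∀ T ⊆ H.vertexSet, T.encard = t → ∃! e, e ∈ H.edgeSet ∧ T ⊆ e

/-- The possible numbers of edges of linear `n`-vertex `k`-uniform hypergraphs with no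
`r`-regular subgraph. -/
def linearRegularFreeSizes (k r n : ℕ) : Set ℕ :=
  {m | ∃ H : Hypergraph (Fin n), H.vertexSet = Set.univ ∧ H.UniformOf k ∧ H.Linear ∧
    ¬ H.HasRegularSubgraph r ∧ H.edgeSet.ncard = m}

/-- `f_{k,r}(n)`: the maximum number of edges of a linear `n`-vertex `k`-uniform hypergraph with
no `r`-regular subgraph. -/
noncomputable def maxLinearRegularFree (k r n : ℕ) : ℕ :=
  sSup (linearRegularFreeSizes k r n)

/-- For `r ≥ 1` the supremum above really is a maximum. -/
theorem isGreatest_maxLinearRegularFree (k n : ℕ) {r : ℕ} (hr : 1 ≤ r) :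
    IsGreatest (linearRegularFreeSizes k r n) (maxLinearRegularFree k r n) := by
  have hb : BddAbove (linearRegularFreeSizes k r n) := by
    refine ⟨(Set.univ : Set (Set (Fin n))).ncard, ?_⟩
    rintro m ⟨H, -, -, -, -, rfl⟩
    exact Set.ncard_le_ncard (Set.subset_univ _) (Set.toFinite _)
  have hne : (linearRegularFreeSizes k r n).Nonempty := by
    refine ⟨0, ⟨Set.univ, ∅, by simp⟩, rfl, by simp [UniformOf], by simp [Linear], ?_, by simp⟩
    rintro ⟨F, hF, S, -, ⟨v, hv⟩, h, -⟩
    have h0 : F = ∅ := Set.subset_empty_iff.mp hF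
    have h1 := h v hv
    simp only [h0, Set.mem_empty_iff_false, false_and, Set.ofPred_false, Set.encard_empty] at h1
    have : (0 : ℕ) = r := by exact_mod_cast h1
    omega
  exact ⟨Nat.sSup_mem hne hb, fun m hm => le_csSup hb hm⟩

end Hypergraph

/-! Superpose `r` matchings that cover the same vertex set. With `n` vertices, degrees at most `D ≥
n` and at least `2kmD` edges, greedy extension gives at least `(kn)^m` matchings of size `m`. Each
covers `mk` vertices, and there are at most `(n/m)^(mk)` sets of that size, so some vertex set `S`
is covered exactly by more than `κ^m` matchings, where `κ = m(m/n)^(k-1)`.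

View each matching as an `m`-set of edges. If `κ log m ≥ 256 r² m`, that is `(m/n)^(k-1) log m ≥ 256
r²`, then `exists_sunflower` yields `r` of these matchings that all contain a set `K` of fewer than
`m` edges and are pairwise disjoint outside it. Deleting `K` and taking the union covers each vertex
of `S` outside the edges of `K` once per matching, hence `r` times (`exists_regular_of_card_edges`).

The sunflower lemma passes to the link of a maximal overpopulated `K`. This link is `κ`-spread, so a
uniformly random `r`-colouring has, with positive probability, a member of the link inside every
colour class. This is proved by exposing a colour class in two rounds and applying the fragment
lemma `exists_fragment` in each.

In a linear hypergraph degrees are at most `n`, and in a Steiner system at most `n^(t-1)`. Suitable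
choices of `m` finish both cases: slightly sublinear in `n` for the former, a constant fraction of
`n` for the latter. -/

/-! ### Spread families: minimum fragments and random colourings. -/

open Finset in
/-- The minimum fragment lemma: for a spread family, most pairs of a member and a weighted random set `W`
leave only a small fragment of some member outside `W`. -/
theorem exists_fragment {α ι : Type*} [DecidableEq α] (Y : Finset α) (I : Finset ι)
    (hI : I.Nonempty) (A : ι → Finset α) (hY : ∀ i ∈ I, A i ⊆ Y) {κ s B : ℝ} (hκ : 0 < κ) (hs : 0 ≤ s) {t : ℕ}
    (hspread : ∀ T : Finset α, T.Nonempty →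
      κ ^ #T * (#{i ∈ I | T ⊆ A i} : ℝ) ≤ #I)
    (hB : ∀ i ∈ I, ∑ T ∈ (A i).powerset with t ≤ #T, (s / κ) ^ #T ≤ B) :
    ∃ χ : ι → Finset α → Finset α,
      (∀ i ∈ I, ∀ W, χ i W ⊆ A i \ W ∧ ∃ j ∈ I, A j \ W = χ i W) ∧
      ∑ W ∈ Y.powerset, (#{i ∈ I | t ≤ #(χ i W)} : ℝ) * s ^ #(Y \ W) ≤
        (s + 1) ^ #Y * #I * B := by
  classical
  have hmin : ∀ i ∈ I, ∀ W : Finset α, ∃ j ∈ I, A j \ W ⊆ A i \ W ∧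
      ∀ l ∈ I, A l \ W ⊆ A i \ W → #(A j \ W) ≤ #(A l \ W) := by
    intro i hi W
    obtain ⟨j, hj, hmin⟩ := exists_min_image ({j ∈ I | A j \ W ⊆ A i \ W})
      (fun j => #(A j \ W)) ⟨i, by simp [hi]⟩
    rw [mem_filter] at hj
    exact ⟨j, hj.1, hj.2, fun l hl hl' => hmin l (mem_filter.2 ⟨hl, hl'⟩)⟩
  choose! g hgI hgsub hgmin using hmin
  -- The representative depends on `Z` alone, so it can be recovered without knowing `W` or `i`.
  have hrep : ∀ Z : Finset α, ∃ i, (∃ j ∈ I, A j ⊆ Z) → i ∈ I ∧ A i ⊆ Z := by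
    intro Z
    by_cases h : ∃ j ∈ I, A j ⊆ Z
    · obtain ⟨j, hj, hjZ⟩ := h
      exact ⟨j, fun _ => ⟨hj, hjZ⟩⟩
    · exact ⟨hI.choose, fun h' => (h h').elim⟩
  choose rep hrep using hrep
  refine ⟨fun i W => A (g i W) \ W, fun i hi W => ⟨hgsub i hi W, g i W, hgI i hi W, rfl⟩, ?_⟩
  set χ : ι → Finset α → Finset α := fun i W => A (g i W) \ W with hχ
  have hρ : 0 ≤ s / κ := by positivity
  let P : Finset (Finset α × ι) :=
    {x ∈ Y.powerset ×ˢ I | t ≤ #(χ x.2 x.1)}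
  let Q : Finset (Σ _ : Finset α, Σ _ : Finset α, ι) :=
    {Z ∈ Y.powerset | ∃ j ∈ I, A j ⊆ Z}.sigma fun Z =>
      {T ∈ (A (rep Z)).powerset | t ≤ #T}.sigma fun T => {i ∈ I | T ⊆ A i}
  -- Encode `(W, i)` by `Z = W ∪ T`, the fragment `T`, and `i`. Here `W = Z \ T`, so the code is
  -- injective, and the weight splits as `s ^ #(Y \ Z) * s ^ #T`. Given `Z`, the set `T` is a subset
  -- of one fixed member; given `T`, spreadness leaves at most `#I / κ ^ #T` indices.
  let φ : Finset α × ι → (Σ _ : Finset α, Σ _ : Finset α, ι) :=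
    fun x => ⟨x.1 ∪ χ x.2 x.1, χ x.2 x.1, x.2⟩
  have hlhs : ∑ W ∈ Y.powerset, (#{i ∈ I | t ≤ #(χ i W)} : ℝ) * s ^ #(Y \ W) =
      ∑ x ∈ P, s ^ #(Y \ x.1) := by
    rw [sum_filter, sum_product]
    refine sum_congr rfl fun W _ => ?_
    simp only [← sum_filter, sum_const, nsmul_eq_mul]
  have hdisj : ∀ i W, Disjoint W (χ i W) := fun i W => disjoint_sdiff
  have hmaps : ∀ x ∈ P, φ x ∈ Q := by
    rintro ⟨W, i⟩ hx
    simp only [P, mem_filter, mem_product, mem_powerset] at hx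
    obtain ⟨⟨hW, hi⟩, ht⟩ := hx
    have hgZ : A (g i W) ⊆ W ∪ χ i W := by
      intro a ha
      by_cases haW : a ∈ W <;> simp [χ, ha, haW]
    have hχA : χ i W ⊆ A i := (hgsub i hi W).trans sdiff_subset
    obtain ⟨hrI, hrZ⟩ := hrep (W ∪ χ i W) ⟨_, hgI i hi W, hgZ⟩
    have hsub : A (rep (W ∪ χ i W)) \ W ⊆ χ i W := by
      intro a ha
      rw [mem_sdiff] at ha
      exact (mem_union.1 (hrZ ha.1)).resolve_left ha.2
    -- The representative also leaves a fragment inside `A i \ W`, so minimality of `χ i W` forces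
    -- equality; hence the fragment lies inside the representative.
    have heq : A (rep (W ∪ χ i W)) \ W = χ i W :=
      eq_of_subset_of_card_le hsub (hgmin i hi W _ hrI (hsub.trans (hgsub i hi W)))
    simp only [Q, φ, mem_sigma, mem_filter, mem_powerset]
    refine ⟨⟨union_subset hW (hχA.trans (hY i hi)), _, hgI i hi W, hgZ⟩, ⟨?_, ht⟩, hi, hχA⟩
    exact heq.symm.subset.trans sdiff_subset
  have hinj : Set.InjOn φ P := by
    rintro ⟨W, i⟩ _ ⟨W', i'⟩ _ h
    simp only [φ, Sigma.mk.injEq, heq_eq_eq] at h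
    obtain ⟨h1, h2, rfl⟩ := h
    have e1 : (W ∪ χ i W) \ χ i W = W := by
      rw [union_sdiff_right, (hdisj i W).sdiff_eq_left]
    have e2 : (W' ∪ χ i W') \ χ i W' = W' := by
      rw [union_sdiff_right, (hdisj i W').sdiff_eq_left]
    rw [← e1, ← e2, h1, h2]
  have hw : ∀ x ∈ P, s ^ #(Y \ x.1) = s ^ #(Y \ (φ x).1) * s ^ #(φ x).2.1 := by
    rintro ⟨W, i⟩ hx
    have hQ := hmaps _ hx
    simp only [P, mem_filter, mem_product, mem_powerset] at hx
    have hχY : χ i W ⊆ Y := ((hgsub i hx.1.2 W).trans sdiff_subset).trans (hY i hx.1.2)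
    simp only [φ]
    rw [← pow_add]
    congr 1
    rw [← card_union_of_disjoint]
    · congr 1
      ext a
      have := @hχY a
      have h2 : a ∈ χ i W → a ∉ W := fun h1 h2 => (disjoint_left.1 (hdisj i W)) h2 h1
      simp only [mem_sdiff, mem_union]
      tauto
    · rw [disjoint_left]
      intro a
      simp only [mem_sdiff, mem_union]
      tauto
  rw [hlhs, sum_congr rfl hw, ← sum_image (g := φ)
    (f := fun y : (Σ _ : Finset α, Σ _ : Finset α, ι) => s ^ #(Y \ y.1) * s ^ #y.2.1) hinj]
  calc _ ≤ ∑ y ∈ Q, s ^ #(Y \ y.1) * s ^ #y.2.1 := by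
        refine sum_le_sum_of_subset_of_nonneg (image_subset_iff.2 hmaps) fun y _ _ => by positivity
    _ ≤ ∑ Z ∈ Y.powerset with ∃ j ∈ I, A j ⊆ Z, s ^ #(Y \ Z) * (#I * B) := by
        rw [sum_sigma]
        refine sum_le_sum fun Z hZ => ?_
        dsimp only
        rw [← mul_sum]
        refine mul_le_mul_of_nonneg_left ?_ (by positivity)
        rw [sum_sigma]
        have hr := hrep Z (mem_filter.1 hZ).2
        refine le_trans ?_ (mul_le_mul_of_nonneg_left (hB _ hr.1) (by positivity))
        rw [mul_sum]
        refine sum_le_sum fun T _ => ?_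
        simp only [sum_const, nsmul_eq_mul]
        rcases T.eq_empty_or_nonempty with rfl | hT
        · simp
        · rw [div_pow, mul_div_assoc', le_div_iff₀ (by positivity)]
          nlinarith [mul_le_mul_of_nonneg_right (hspread T hT) (pow_nonneg hs #T)]
    _ ≤ ∑ Z ∈ Y.powerset, s ^ #(Y \ Z) * (#I * B) := by
        have hB0 : 0 ≤ B :=
          le_trans (sum_nonneg fun _ _ => by positivity) (hB _ hI.choose_spec)
        exact sum_le_sum_of_subset_of_nonneg (filter_subset _ _) fun _ _ _ => by positivity
    _ = _ := by
        rw [← sum_mul, mul_assoc]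
        congr 1
        have := sum_pow_mul_eq_add_pow (1 : ℝ) s Y
        rw [add_comm, ← this]
        refine sum_congr rfl fun Z hZ => ?_
        rw [card_sdiff_of_subset (mem_powerset.1 hZ)]
        simp

-- Two-round exposure. Giving each point weight 1 in `W`, 1 in `U` and `s` in neither makes the
-- total weight `(s + 2) ^ Fintype.card α`, so the last factor bounds a failure probability. The
-- first round shrinks most sets to fragments of size below `t`; the second swallows some fragment
-- whole.
open Finset in
theorem sum_union_avoiding_le {α ι : Type*} [DecidableEq α] [Fintype α] (I : Finset ι)
    (hI : I.Nonempty) (A : ι → Finset α) {κ s : ℝ} (hs : 0 ≤ s) (hsκ : s + 1 ≤ κ) {m t : ℕ}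
    (hm : ∀ i ∈ I, #(A i) ≤ m)
    (hspread : ∀ T : Finset α, T.Nonempty → κ ^ #T * (#{i ∈ I | T ⊆ A i} : ℝ) ≤ #I) :
    ∑ W : Finset α, ∑ U ∈ (univ \ W).powerset with ∀ i ∈ I, ¬ A i ⊆ W ∪ U,
        s ^ #((univ \ W) \ U) ≤
      (s + 2) ^ Fintype.card α *
        (2 * (2 ^ m * ((s + 1) / κ) ^ t) + ((1 + 2 * s / κ) ^ t - 1)) := by
  classical
  have hκ : 0 < κ := by linarith
  have hρ : (s + 1) / κ ≤ 1 := (div_le_one hκ).2 hsκ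
  have hρ0 : 0 ≤ (s + 1) / κ := by positivity
  have hIpos : (0 : ℝ) < #I := by exact_mod_cast hI.card_pos
  obtain ⟨χ, hχ, hsum⟩ := exists_fragment (univ : Finset α) I hI A (fun _ _ => subset_univ _)
    hκ (by linarith : 0 ≤ s + 1) (t := t) (B := 2 ^ m * ((s + 1) / κ) ^ t) hspread (by
      intro i hi
      calc _ ≤ ∑ T ∈ (A i).powerset with t ≤ #T, ((s + 1) / κ) ^ t :=
            sum_le_sum fun T hT => pow_le_pow_of_le_one hρ0 hρ (mem_filter.1 hT).2
        _ = #{T ∈ (A i).powerset | t ≤ #T} * ((s + 1) / κ) ^ t := by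
            rw [sum_const, nsmul_eq_mul]
        _ ≤ _ := by
            refine mul_le_mul_of_nonneg_right ?_ (by positivity)
            have h1 : #{T ∈ (A i).powerset | t ≤ #T} ≤ 2 ^ m :=
              (card_filter_le _ _).trans ((card_powerset _).le.trans
                (Nat.pow_le_pow_right (by norm_num) (hm i hi)))
            exact_mod_cast h1)
  set B₁ : ℝ := 2 ^ m * ((s + 1) / κ) ^ t
  set B₂ : ℝ := (1 + 2 * s / κ) ^ t - 1 with hB₂
  have hB₂0 : 0 ≤ B₂ := by
    have : 1 ≤ (1 + 2 * s / κ) ^ t := one_le_pow₀ (by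
      have : 0 ≤ 2 * s / κ := by positivity
      linarith)
    linarith
  have htotal : ∀ Y : Finset α, ∑ U ∈ Y.powerset, s ^ #(Y \ U) = (s + 1) ^ #Y := by
    intro Y
    have := sum_pow_mul_eq_add_pow (1 : ℝ) s Y
    rw [add_comm s, ← this]
    refine sum_congr rfl fun U hU => ?_
    rw [card_sdiff_of_subset (mem_powerset.1 hU)]
    simp
  have key : ∀ W : Finset α,
      ∑ U ∈ (univ \ W).powerset with ∀ i ∈ I, ¬ A i ⊆ W ∪ U, s ^ #((univ \ W) \ U) ≤
        (s + 1) ^ #(univ \ W) * (2 * #{i ∈ I | t ≤ #(χ i W)} / #I + B₂) := by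
    intro W
    -- Markov's inequality: if at least half of the fragments are large, the trivial bound is
    -- already covered by the first term.
    by_cases hbad : (#I : ℝ) ≤ 2 * #{i ∈ I | t ≤ #(χ i W)}
    · calc _ ≤ ∑ U ∈ (univ \ W).powerset, s ^ #((univ \ W) \ U) :=
            sum_le_sum_of_subset_of_nonneg (filter_subset _ _) fun _ _ _ => by positivity
        _ = (s + 1) ^ #(univ \ W) * 1 := by rw [htotal, mul_one]
        _ ≤ _ := by
            refine mul_le_mul_of_nonneg_left ?_ (by positivity)
            have := (one_le_div hIpos).2 hbad
            linarith
    · rw [not_le] at hbad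
      set I' : Finset ι := {i ∈ I | #(χ i W) < t} with hI'
      have hcard : (#I' : ℝ) + #{i ∈ I | t ≤ #(χ i W)} = #I := by
        have := card_filter_add_card_filter_not (s := I) (fun i => #(χ i W) < t)
        simp only [not_lt] at this
        exact_mod_cast this
      have hI'pos : (0 : ℝ) < #I' := by linarith
      have hI'ne : I'.Nonempty := by
        rw [← card_pos]
        exact_mod_cast hI'pos
      have hI'I : ∀ i ∈ I', i ∈ I := fun i hi => (mem_filter.1 hi).1
      have hχA : ∀ i ∈ I', χ i W ⊆ A i \ W := fun i hi => (hχ i (hI'I i hi) W).1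
      -- The small fragments come from more than half of `I`. The lost factor 2 is absorbed by `2 ^
      -- #T`, so they are `κ / 2`-spread. Threshold 1 asks for an empty fragment, that is, a member
      -- contained in `W ∪ U`.
      obtain ⟨ψ, hψ, hsum'⟩ := exists_fragment (univ \ W) I' hI'ne (fun i => χ i W)
        (fun i hi => (hχA i hi).trans (sdiff_subset_sdiff (subset_univ _) subset_rfl))
        (by linarith : 0 < κ / 2) hs (t := 1) (B := B₂) (by
          intro T hT
          have h1 : (#{i ∈ I' | T ⊆ χ i W} : ℝ) ≤ #{i ∈ I | T ⊆ A i} := by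
            refine mod_cast card_le_card fun i hi => ?_
            rw [mem_filter] at hi ⊢
            exact ⟨hI'I i hi.1, hi.2.trans ((hχA i hi.1).trans sdiff_subset)⟩
          have h2 : (2 : ℝ) ≤ 2 ^ #T := by
            calc (2 : ℝ) = 2 ^ 1 := by norm_num
              _ ≤ _ := pow_le_pow_right₀ (by norm_num) hT.card_pos
          rw [div_pow, div_mul_eq_mul_div, div_le_iff₀ (by positivity)]
          calc _ ≤ κ ^ #T * (#{i ∈ I | T ⊆ A i} : ℝ) :=
                mul_le_mul_of_nonneg_left h1 (by positivity)
            _ ≤ #I := hspread T hT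
            _ ≤ #I' * 2 := by linarith
            _ ≤ _ := mul_le_mul_of_nonneg_left h2 hI'pos.le) (by
          intro i hi
          have h1 : s / (κ / 2) = 2 * s / κ := by field_simp
          have h2 : #(χ i W) ≤ t := (mem_filter.1 hi).2.le
          have h3 := sum_pow_mul_eq_add_pow (2 * s / κ) (1 : ℝ) (χ i W)
          have h4 : (1 + 2 * s / κ) ^ #(χ i W) ≤ (1 + 2 * s / κ) ^ t := by
            refine pow_le_pow_right₀ ?_ h2
            have : 0 ≤ 2 * s / κ := by positivity
            linarith
          rw [h1]
          have h5 : ({T ∈ (χ i W).powerset | 1 ≤ #T} : Finset (Finset α)) =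
              (χ i W).powerset.erase ∅ := by
            ext T
            simp only [mem_filter, mem_erase, Nat.one_le_iff_ne_zero, ne_eq, card_eq_zero]
            tauto
          rw [h5]
          have h6 := add_sum_erase (χ i W).powerset (fun T => (2 * s / κ) ^ #T)
            (empty_mem_powerset _)
          simp only [one_pow, mul_one, card_empty, pow_zero] at h3 h6
          rw [h3, add_comm (2 * s / κ)] at h6
          linarith)
      have hle : (∑ U ∈ (univ \ W).powerset with ∀ i ∈ I, ¬ A i ⊆ W ∪ U,
          s ^ #((univ \ W) \ U)) * #I' ≤ (s + 1) ^ #(univ \ W) * #I' * B₂ := by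
        refine le_trans ?_ hsum'
        rw [sum_mul]
        calc _ = ∑ U ∈ (univ \ W).powerset with ∀ i ∈ I, ¬ A i ⊆ W ∪ U,
              (#{i ∈ I' | 1 ≤ #(ψ i U)} : ℝ) * s ^ #((univ \ W) \ U) := by
                refine sum_congr rfl fun U hU => ?_
                rw [mul_comm]
                congr 3
                symm
                rw [filter_eq_self]
                intro i hi
                by_contra hcon
                have h0 : ψ i U = ∅ := by
                  rw [← card_eq_zero]; omega
                obtain ⟨j, hj, hjU⟩ := (hψ i hi U).2
                rw [h0, sdiff_eq_empty_iff_subset] at hjU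
                obtain ⟨l, hl, hlW⟩ := (hχ j (hI'I j hj) W).2
                refine (mem_filter.1 hU).2 l hl ?_
                intro a ha
                by_cases haW : a ∈ W
                · exact mem_union_left _ haW
                · exact mem_union_right _ (hjU (hlW.subset (mem_sdiff.2 ⟨ha, haW⟩)))
          _ ≤ _ := sum_le_sum_of_subset_of_nonneg (filter_subset _ _)
                fun _ _ _ => by positivity
      have hle' : (∑ U ∈ (univ \ W).powerset with ∀ i ∈ I, ¬ A i ⊆ W ∪ U,
          s ^ #((univ \ W) \ U)) ≤ (s + 1) ^ #(univ \ W) * B₂ := by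
        refine le_of_mul_le_mul_right ?_ hI'pos
        linarith
      refine hle'.trans (mul_le_mul_of_nonneg_left ?_ (by positivity))
      have : (0 : ℝ) ≤ 2 * #{i ∈ I | t ≤ #(χ i W)} / #I := by positivity
      linarith
  calc _ ≤ ∑ W : Finset α,
        (s + 1) ^ #(univ \ W) * (2 * #{i ∈ I | t ≤ #(χ i W)} / #I + B₂) :=
        sum_le_sum fun W _ => key W
    _ = 2 / #I * (∑ W : Finset α, (#{i ∈ I | t ≤ #(χ i W)} : ℝ) * (s + 1) ^ #(univ \ W)) +
        (∑ W : Finset α, (s + 1) ^ #(univ \ W)) * B₂ := by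
        rw [mul_sum, sum_mul, ← sum_add_distrib]
        refine sum_congr rfl fun W _ => ?_
        ring
    _ ≤ 2 / #I * ((s + 1 + 1) ^ #(univ : Finset α) * #I * B₁) +
        (s + 2) ^ Fintype.card α * B₂ := by
        refine add_le_add (mul_le_mul_of_nonneg_left ?_ (by positivity))
          (mul_le_mul_of_nonneg_right ?_ hB₂0)
        · rwa [powerset_univ] at hsum
        · have := sum_pow_mul_eq_add_pow (1 : ℝ) (s + 1) (univ : Finset α)
          rw [powerset_univ, card_univ] at this
          rw [show s + 2 = 1 + (s + 1) by ring, ← this]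
          refine (sum_congr rfl fun U _ => ?_).le
          rw [card_sdiff_of_subset (subset_univ _)]
          simp
    _ = _ := by
        rw [card_univ]
        field_simp
        ring

open Finset in
theorem card_coloring_fiber {α : Type*} [DecidableEq α] [Fintype α] {r : ℕ} (i : Fin r)
    (V : Finset α) :
    #{c : α → Fin r | univ.filter (c · = i) = V} = (r - 1) ^ #(univ \ V) := by
  have h : ({c : α → Fin r | univ.filter (c · = i) = V} : Finset (α → Fin r)) =
      Fintype.piFinset fun x => if x ∈ V then {i} else univ.erase i := by
    ext c
    simp only [mem_filter, mem_univ, true_and, Fintype.mem_piFinset, Finset.ext_iff]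
    refine forall_congr' fun x => ?_
    by_cases hx : x ∈ V <;> simp [hx]
  rw [h, Fintype.card_piFinset]
  have h2 : ∀ x, #(if x ∈ V then {i} else univ.erase i) = if x ∈ V then 1 else r - 1 := by
    intro x
    split_ifs <;> simp
  simp only [h2, prod_ite, prod_const, one_pow, one_mul]
  congr 2
  ext x; simp

-- A colour class of a uniform colouring contains each point independently with probability `1 / r`.
-- If each class misses all members with probability below `1 / r`, a union bound over the colours
-- leaves a good colouring.
open Finset in
theorem exists_coloring_of_spread {α ι : Type*} [DecidableEq α] [Fintype α] (I : Finset ι)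
    (hI : I.Nonempty) (A : ι → Finset α) {r : ℕ} (hr : 1 ≤ r) {κ : ℝ} (hrκ : 2 * r ≤ κ)
    {m t : ℕ} (hm : ∀ i ∈ I, #(A i) ≤ m)
    (hspread : ∀ T : Finset α, T.Nonempty → κ ^ #T * (#{i ∈ I | T ⊆ A i} : ℝ) ≤ #I)
    (hlt : 2 * (2 ^ m * (2 * r / κ) ^ t) + ((1 + 4 * r / κ) ^ t - 1) < 1 / (r : ℝ)) :
    ∃ c : α → Fin r, ∀ a : Fin r, ∃ i ∈ I, ∀ x ∈ A i, c x = a := by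
  classical
  by_contra hcon
  push Not at hcon
  have hr' : (1 : ℝ) ≤ r := by exact_mod_cast hr
  have hκ : 0 < κ := by linarith
  set N := Fintype.card α
  -- With this weight a point falls in `W ∪ U` with probability `2 / (s + 2) = 1 / r`, as for a
  -- colour class.
  set s : ℝ := 2 * r - 2 with hs
  let bad : Finset α → Prop := fun V => ∀ i ∈ I, ¬ A i ⊆ V
  have hcover : (r : ℝ) ^ N ≤
      r * ∑ V : Finset α with bad V, ((r : ℝ) - 1) ^ #(univ \ V) := by
    have h1 : (univ : Finset (α → Fin r)) ⊆ univ.biUnion fun a : Fin r =>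
        (univ.filter bad).biUnion fun V => {c : α → Fin r | univ.filter (c · = a) = V} := by
      intro c _
      obtain ⟨a, ha⟩ := hcon c
      simp only [mem_biUnion, mem_filter, mem_univ, true_and]
      refine ⟨a, _, ?_, rfl⟩
      intro i hi hsub
      obtain ⟨x, hx, hxa⟩ := ha i hi
      exact hxa (by simpa using hsub hx)
    have h2 := card_le_card h1
    have h3 : Fintype.card (α → Fin r) ≤ r * ∑ V with bad V, (r - 1) ^ #(univ \ V) := by
      calc _ ≤ _ := h2
        _ ≤ ∑ a : Fin r, ∑ V with bad V,
            #{c : α → Fin r | univ.filter (c · = a) = V} :=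
            card_biUnion_le.trans (sum_le_sum fun a _ => card_biUnion_le)
        _ = _ := by simp [card_coloring_fiber]
    rw [Fintype.card_fun, Fintype.card_fin] at h3
    have h4 : ((r - 1 : ℕ) : ℝ) = (r : ℝ) - 1 := by push_cast [hr]; ring
    rw [← h4]
    exact_mod_cast h3
  have hswap : (2 : ℝ) ^ N * ∑ V : Finset α with bad V, ((r : ℝ) - 1) ^ #(univ \ V) =
      ∑ W : Finset α, ∑ U ∈ (univ \ W).powerset with ∀ i ∈ I, ¬ A i ⊆ W ∪ U,
        s ^ #((univ \ W) \ U) := by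
    have h1 : ∀ V : Finset α, (2 : ℝ) ^ N * ((r : ℝ) - 1) ^ #(univ \ V) =
        ∑ W ∈ V.powerset, s ^ #(univ \ V) := by
      intro V
      have hN : N = #V + #(univ \ V) := by
        rw [card_sdiff_of_subset (subset_univ _), card_univ]
        have := card_le_univ V
        omega
      rw [sum_const, card_powerset, nsmul_eq_mul, hN, pow_add, mul_assoc, ← mul_pow, hs]
      push_cast
      congr 2
      ring
    rw [mul_sum, sum_congr rfl fun V _ => h1 V, sum_sigma', sum_sigma']
    refine sum_bij' (fun x _ => ⟨x.2, x.1 \ x.2⟩) (fun y _ => ⟨y.1 ∪ y.2, y.1⟩) ?_ ?_ ?_ ?_ ?_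
    · rintro ⟨V, W⟩ h
      simp only [mem_sigma, mem_filter, mem_univ, true_and, mem_powerset] at h ⊢
      rw [union_sdiff_of_subset h.2]
      exact ⟨sdiff_subset_sdiff (subset_univ _) subset_rfl, h.1⟩
    · rintro ⟨W, U⟩ h
      simp only [mem_sigma, mem_filter, mem_univ, true_and, mem_powerset] at h ⊢
      exact ⟨h.2, subset_union_left⟩
    · rintro ⟨V, W⟩ h
      simp only [mem_sigma, mem_filter, mem_univ, true_and, mem_powerset] at h
      simp [union_sdiff_of_subset h.2]
    · rintro ⟨W, U⟩ h
      simp only [mem_sigma, mem_filter, mem_univ, true_and, mem_powerset] at h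
      have : U \ W = U := by
        rw [sdiff_eq_left]
        exact disjoint_of_subset_left h.1 sdiff_disjoint
      simp [union_sdiff_left, this]
    · rintro ⟨V, W⟩ h
      simp only [mem_sigma, mem_filter, mem_univ, true_and, mem_powerset] at h
      dsimp only
      congr 2
      ext x
      have := @h.2 x
      simp only [mem_sdiff, mem_univ, true_and]
      tauto
  have htwo := sum_union_avoiding_le I hI A (s := s) (t := t) (by linarith) (by linarith) hm hspread
  rw [← hswap, show s + 2 = 2 * r by rw [hs]; ring, mul_pow, mul_assoc] at htwo
  have htwo' := le_of_mul_le_mul_left htwo (by positivity)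
  have hmono : 2 * (2 ^ m * ((s + 1) / κ) ^ t) + ((1 + 2 * s / κ) ^ t - 1) ≤
      2 * (2 ^ m * (2 * r / κ) ^ t) + ((1 + 4 * r / κ) ^ t - 1) := by
    have hs0 : 0 ≤ s := by linarith
    have h1 : (s + 1) / κ ≤ 2 * r / κ := div_le_div_of_nonneg_right (by linarith) hκ.le
    have h2 : 2 * s / κ ≤ 4 * r / κ := div_le_div_of_nonneg_right (by linarith) hκ.le
    have h3 : 0 ≤ (s + 1) / κ := by positivity
    have h4 : 0 ≤ 2 * s / κ := by positivity
    gcongr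
  have hrN : (0 : ℝ) < (r : ℝ) ^ N := by positivity
  have : (r : ℝ) ^ N < (r : ℝ) ^ N := by
    calc (r : ℝ) ^ N ≤ _ := hcover
      _ ≤ r * ((r : ℝ) ^ N *
          (2 * (2 ^ m * ((s + 1) / κ) ^ t) + ((1 + 2 * s / κ) ^ t - 1))) :=
          mul_le_mul_of_nonneg_left htwo' (by positivity)
      _ < r * ((r : ℝ) ^ N * (1 / r)) := by
          refine mul_lt_mul_of_pos_left (mul_lt_mul_of_pos_left ?_ hrN) (by linarith)
          exact hmono.trans_lt hlt
      _ = _ := by field_simp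
  exact lt_irrefl _ this

/-- Take `t` about `4m / log m`. Since `κ ≥ 2r√m`, the factor `(2r/κ)^t` is at most `exp (-2m)`,
which beats `2^m`. Also `4rt/κ ≤ 1/(8r)`, which is where the constant 256 is spent. The two terms
sum to less than `3/(4r)`. -/
theorem exists_threshold {m r : ℕ} (hr : 1 ≤ r) (hm : 4 * r < m) {κ : ℝ}
    (hκ : 256 * (r : ℝ) ^ 2 * m ≤ κ * Real.log m) :
    2 * r ≤ κ ∧ ∃ t : ℕ,
      2 * (2 ^ m * (2 * r / κ) ^ t) + ((1 + 4 * r / κ) ^ t - 1) < 1 / (r : ℝ) := by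
  have hr' : (1 : ℝ) ≤ r := by exact_mod_cast hr
  have hm' : 4 * (r : ℝ) < m := by exact_mod_cast hm
  have hmpos : (0 : ℝ) < m := by linarith
  have hℓ : 0 < Real.log m := Real.log_pos (by linarith)
  set l := Real.log m with hl
  have hκpos : 0 < κ := by
    by_contra h
    have : κ * l ≤ 0 := mul_nonpos_of_nonpos_of_nonneg (not_lt.1 h) hℓ.le
    have : 0 < 256 * (r : ℝ) ^ 2 * m := by positivity
    linarith
  have hlm : l ≤ m := (Real.log_le_sub_one_of_pos hmpos).trans (by linarith)
  have hlsqrt : l ≤ 2 * √m := by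
    have h1 : Real.log (√m) = l / 2 := Real.log_sqrt hmpos.le
    have h2 := Real.log_le_sub_one_of_pos (Real.sqrt_pos.2 hmpos)
    linarith
  have hsq : √(m : ℝ) * √m = m := Real.mul_self_sqrt hmpos.le
  have hsqpos := Real.sqrt_pos.2 hmpos
  have hκ2 : 2 * r * √m ≤ κ := by
    have h1 : 256 * (r : ℝ) ^ 2 * (√m * √m) ≤ κ * (2 * √m) := by
      rw [hsq]
      exact hκ.trans (mul_le_mul_of_nonneg_left hlsqrt hκpos.le)
    have h2 : 256 * (r : ℝ) ^ 2 * √m ≤ κ * 2 := by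
      refine le_of_mul_le_mul_right ?_ hsqpos
      linarith
    have h3 : (r : ℝ) * √m ≤ r ^ 2 * √m :=
      mul_le_mul_of_nonneg_right (by nlinarith) hsqpos.le
    nlinarith
  have hsq1 : 1 ≤ √(m : ℝ) := Real.one_le_sqrt.2 (by linarith)
  refine ⟨by nlinarith, ⌈4 * m / l⌉₊, ?_⟩
  set t := ⌈4 * m / l⌉₊
  have ht1 : 4 * m / l ≤ t := Nat.le_ceil _
  have ht2 : t ≤ 8 * m / l := by
    have h1 : (t : ℝ) < 4 * m / l + 1 := Nat.ceil_lt_add_one (by positivity)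
    have h2 : 1 ≤ m / l := (one_le_div hℓ).2 hlm
    have h3 : 8 * m / l = 4 * m / l + 4 * (m / l) := by ring
    linarith
  have hB₁ : (2 : ℝ) ^ m * (2 * r / κ) ^ t < 1 / (4 * r) := by
    have h1 : 2 * r / κ ≤ Real.exp (-(l / 2)) := by
      rw [← Real.log_sqrt hmpos.le, Real.exp_neg, Real.exp_log hsqpos, div_le_iff₀ hκpos,
        ← div_eq_inv_mul, le_div_iff₀ hsqpos]
      exact hκ2
    have h2 : (2 * r / κ) ^ t ≤ Real.exp (-(2 * m)) := by
      refine (pow_le_pow_left₀ (by positivity) h1 t).trans ?_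
      rw [← Real.exp_nat_mul, Real.exp_le_exp]
      rw [div_le_iff₀ hℓ] at ht1
      linarith
    have h3 : (2 : ℝ) ^ m ≤ Real.exp m := by
      rw [← mul_one (m : ℝ), Real.exp_nat_mul]
      refine pow_le_pow_left₀ (by norm_num) ?_ m
      have := Real.add_one_le_exp 1
      linarith
    calc (2 : ℝ) ^ m * (2 * r / κ) ^ t ≤ Real.exp m * Real.exp (-(2 * m)) := by gcongr
      _ = (Real.exp m)⁻¹ := by rw [← Real.exp_add, ← Real.exp_neg]; congr 1; ring
      _ < 1 / (4 * r) := by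
        rw [one_div]
        refine inv_strictAnti₀ (by positivity) ?_
        have := Real.add_one_le_exp (m : ℝ)
        linarith
  have hB₂ : (1 + 4 * r / κ) ^ t - 1 ≤ 1 / (4 * r) := by
    set y : ℝ := 4 * r / κ * t
    have hy0 : 0 ≤ y := by positivity
    have hy : y ≤ 1 / (8 * r) := by
      calc y ≤ 4 * r / κ * (8 * m / l) := by
            exact mul_le_mul_of_nonneg_left ht2 (by positivity)
        _ = 32 * r * m / (κ * l) := by field_simp; ring
        _ ≤ _ := by
          rw [div_le_div_iff₀ (by positivity) (by positivity)]
          linarith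
    have hy1 : y ≤ 1 := hy.trans (by
      rw [div_le_one (by positivity)]
      linarith)
    have h1 : (1 + 4 * r / κ) ^ t ≤ Real.exp y := by
      rw [show y = t * (4 * r / κ) by simp only [y]; ring, Real.exp_nat_mul]
      refine pow_le_pow_left₀ (by positivity) ?_ t
      linarith [Real.add_one_le_exp (4 * r / κ)]
    have h2 : Real.exp y - 1 ≤ 2 * y := by
      have := Real.abs_exp_sub_one_le (x := y) (by rwa [abs_of_nonneg hy0])
      rw [abs_of_nonneg hy0] at this
      exact (le_abs_self _).trans this
    have h3 : 2 * (1 / (8 * (r : ℝ))) = 1 / (4 * r) := by field_simp; norm_num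
    linarith
  have h3 : 2 * (1 / (4 * (r : ℝ))) + 1 / (4 * r) < 1 / r := by
    have : 1 / (4 * (r : ℝ)) = 1 / 4 * (1 / r) := by field_simp
    have h4 : 0 < 1 / (r : ℝ) := by positivity
    rw [this]
    linarith
  linarith

/-! ### The sunflower lemma. -/

open Finset in
/-- A sunflower lemma for families of more than `κ ^ m` sets of size `m`, where
`κ = 256 r² m / log m`. -/
theorem exists_sunflower {α : Type*} [DecidableEq α] [Fintype α] {m r : ℕ} (hr : 1 ≤ r)
    (hm : 4 * r < m) {κ : ℝ} (hκ : 256 * (r : ℝ) ^ 2 * m ≤ κ * Real.log m)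
    (𝓕 : Finset (Finset α)) (h𝓕 : ∀ S ∈ 𝓕, #S = m) (hcard : κ ^ m < #𝓕) :
    ∃ (K : Finset α) (S : Fin r → Finset α), #K < m ∧
      (∀ a, S a ∈ 𝓕 ∧ K ⊆ S a) ∧ Pairwise fun a b => Disjoint (S a \ K) (S b \ K) := by
  classical
  obtain ⟨hκr, t, ht⟩ := exists_threshold hr hm hκ
  have hr' : (1 : ℝ) ≤ r := by exact_mod_cast hr
  have hκ1 : 1 ≤ κ := by linarith
  have hκ0 : 0 < κ := by linarith
  -- The empty set is heavy by `hcard`. For a heavy `K` of maximum size no `K ∪ T`, with `T`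
  -- nonempty and disjoint from `K`, is heavy; this says that the link of `K` is `κ`-spread.
  let heavy : Finset (Finset α) := {K | κ ^ m < κ ^ #K * (#{S ∈ 𝓕 | K ⊆ S} : ℝ)}
  have hne : heavy.Nonempty := ⟨∅, by simpa [heavy] using hcard⟩
  obtain ⟨K, hK, hmax⟩ := exists_max_image heavy card hne
  simp only [heavy, mem_filter, mem_univ, true_and] at hK hmax
  set I : Finset (Finset α) := {S ∈ 𝓕 | K ⊆ S} with hI
  have hIpos : (0 : ℝ) < #I := by
    by_contra h
    have h0 : (#I : ℝ) = 0 := le_antisymm (not_lt.1 h) (by positivity)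
    rw [h0, mul_zero] at hK
    exact absurd hK (not_lt.2 (by positivity))
  have hIne : I.Nonempty := by
    rw [← card_pos]
    exact_mod_cast hIpos
  have hKm : #K < m := by
    obtain ⟨S, hS⟩ := hIne
    rw [hI, mem_filter] at hS
    -- A heavy `K` of size `m` would lie in at least two members, but an `m`-set contains `K` only
    -- by equalling it.
    refine lt_of_le_of_ne ((card_le_card hS.2).trans (h𝓕 S hS.1).le) fun heq => ?_
    have h1 : #I ≤ 1 := by
      rw [card_le_one]
      intro S₁ h₁ S₂ h₂
      rw [hI, mem_filter] at h₁ h₂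
      rw [← eq_of_subset_of_card_le h₁.2 (by rw [h𝓕 _ h₁.1, heq]),
        ← eq_of_subset_of_card_le h₂.2 (by rw [h𝓕 _ h₂.1, heq])]
    have h2 : (#I : ℝ) ≤ 1 := by exact_mod_cast h1
    rw [heq] at hK
    nlinarith [pow_pos hκ0 m]
  obtain ⟨c, hc⟩ := exists_coloring_of_spread I hIne (fun S => S \ K) hr hκr (m := m) (t := t)
    (fun S hS => (card_le_card sdiff_subset).trans (h𝓕 S (mem_filter.1 hS).1).le) (by
      intro T hT
      by_cases hdis : Disjoint K T
      · have h1 : ¬ κ ^ m < κ ^ #(K ∪ T) * (#{S ∈ 𝓕 | K ∪ T ⊆ S} : ℝ) := by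
          intro h
          have := hmax _ h
          rw [card_union_of_disjoint hdis] at this
          have := hT.card_pos
          omega
        have h2 : #{S ∈ I | T ⊆ S \ K} ≤ #{S ∈ 𝓕 | K ∪ T ⊆ S} := by
          refine card_le_card fun S hS => ?_
          simp only [hI, mem_filter] at hS ⊢
          exact ⟨hS.1.1, union_subset hS.1.2 (hS.2.trans sdiff_subset)⟩
        have h2' : (#{S ∈ I | T ⊆ S \ K} : ℝ) ≤ #{S ∈ 𝓕 | K ∪ T ⊆ S} := by exact_mod_cast h2
        rw [not_lt, card_union_of_disjoint hdis, pow_add, mul_assoc] at h1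
        refine le_of_mul_le_mul_left ?_ (pow_pos hκ0 #K)
        refine le_trans ?_ (h1.trans hK.le)
        gcongr
      · have h1 : ({S ∈ I | T ⊆ S \ K} : Finset (Finset α)) = ∅ := by
          rw [filter_eq_empty_iff]
          intro S _ hTS
          exact hdis (disjoint_of_subset_right hTS disjoint_sdiff)
        rw [h1]
        simp) ht
  choose S hS hSc using hc
  refine ⟨K, S, hKm, fun a => ⟨(mem_filter.1 (hS a)).1, (mem_filter.1 (hS a)).2⟩, ?_⟩
  intro a b hab
  rw [disjoint_left]
  intro x hxa hxb
  exact hab ((hSc a x hxa).symm.trans (hSc b x hxb))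

/-! ### Counting matchings. -/

open Finset in
/-- The matchings with `m` edges of a finite hypergraph with edge set `E`. -/
def matchings {V : Type*} [DecidableEq V] (E : Finset (Finset V)) (m : ℕ) :
    Finset (Finset (Finset V)) :=
  {M ∈ E.powersetCard m | ∀ e ∈ M, ∀ f ∈ M, e ≠ f → Disjoint e f}

section
variable {V : Type*} [DecidableEq V] {E : Finset (Finset V)}

open Finset

theorem mem_matchings {m : ℕ} {M : Finset (Finset V)} :
    M ∈ matchings E m ↔
      M ⊆ E ∧ #M = m ∧ ∀ e ∈ M, ∀ f ∈ M, e ≠ f → Disjoint e f := by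
  simp [matchings, mem_powersetCard, and_assoc]

theorem card_biUnion_matching {k m : ℕ} (hE : ∀ e ∈ E, #e = k) {M : Finset (Finset V)}
    (hM : M ∈ matchings E m) : #(M.biUnion id) = m * k := by
  rw [mem_matchings] at hM
  rw [card_biUnion (t := id) fun e he f hf hef => hM.2.2 e he f hf hef]
  simp only [id]
  rw [sum_const_nat fun e he => hE e (hM.1 he), hM.2.1]

theorem card_edges_meeting_le {D : ℕ} (hD : ∀ v, #{e ∈ E | v ∈ e} ≤ D) (S : Finset V) :
    #{e ∈ E | ¬ Disjoint e S} ≤ #S * D := by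
  have h : ({e ∈ E | ¬ Disjoint e S} : Finset (Finset V)) ⊆ S.biUnion fun v => {e ∈ E | v ∈ e} := by
    intro e he
    rw [mem_filter, not_disjoint_iff] at he
    obtain ⟨he, v, hve, hvS⟩ := he
    exact mem_biUnion.2 ⟨v, hvS, mem_filter.2 ⟨he, hve⟩⟩
  exact (card_le_card h).trans (card_biUnion_le_card_mul _ _ _ fun v _ => hD v)

/-- Double count inclusions `M ⊆ M'`. At most `jkD` edges meet the `jk` vertices of `M`, so at least
`c` edges extend it, while `M'` has only `j + 1` subsets of size `j`. -/
theorem card_matchings_succ {k D c j : ℕ} (hk : 1 ≤ k) (hE : ∀ e ∈ E, #e = k)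
    (hD : ∀ v, #{e ∈ E | v ∈ e} ≤ D) (hc : c + j * k * D ≤ #E) :
    #(matchings E j) * c ≤ #(matchings E (j + 1)) * (j + 1) := by
  classical
  refine card_mul_le_card_mul (fun M M' : Finset (Finset V) => M ⊆ M') (fun M hM => ?_)
    (fun M' hM' => ?_)
  · have hcov := card_biUnion_matching hE hM
    have hmeet := card_edges_meeting_le hD (M.biUnion id)
    rw [hcov] at hmeet
    have hsplit := card_filter_add_card_filter_not (s := E) (fun e => Disjoint e (M.biUnion id))
    rw [mem_matchings] at hM
    have hdisj : ∀ e, Disjoint e (M.biUnion id) → ∀ f ∈ M, Disjoint e f := fun e he f hf =>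
      disjoint_of_subset_right (subset_biUnion_of_mem id hf) he
    have hnot : ∀ e ∈ E, Disjoint e (M.biUnion id) → e ∉ M := by
      intro e he hd heM
      have h1 := hdisj e hd e heM
      rw [disjoint_self_iff_empty] at h1
      have h2 := hE e he
      rw [h1, card_empty] at h2
      omega
    calc c ≤ #{e ∈ E | Disjoint e (M.biUnion id)} := by omega
      _ = #(({e ∈ E | Disjoint e (M.biUnion id)}).image fun e => insert e M) := by
        refine (card_image_of_injOn ?_).symm
        intro e he f hf hef
        rw [mem_coe, mem_filter] at he hf
        have h1 : e ∈ insert f M := by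
          rw [← show insert e M = insert f M from hef]
          exact mem_insert_self _ _
        exact (mem_insert.1 h1).resolve_right (hnot e he.1 he.2)
      _ ≤ _ := by
        refine card_le_card fun M' hM' => ?_
        obtain ⟨e, he, rfl⟩ := mem_image.1 hM'
        rw [mem_filter] at he
        rw [mem_bipartiteAbove, mem_matchings]
        refine ⟨⟨insert_subset he.1 hM.1, ?_, ?_⟩, subset_insert _ _⟩
        · rw [card_insert_of_notMem (hnot e he.1 he.2), hM.2.1]
        · intro f hf g hg hfg
          rcases mem_insert.1 hf with rfl | hf' <;> rcases mem_insert.1 hg with rfl | hg'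
          · exact (hfg rfl).elim
          · exact hdisj _ he.2 g hg'
          · exact (hdisj _ he.2 f hf').symm
          · exact hM.2.2 f hf' g hg' hfg
  · have h1 : (matchings E j).bipartiteBelow (fun M M' => M ⊆ M') M' ⊆ M'.powersetCard j := by
      intro M hM
      rw [mem_bipartiteBelow, mem_matchings] at hM
      exact mem_powersetCard.2 ⟨hM.2, hM.1.2.1⟩
    refine (card_le_card h1).trans ?_
    rw [card_powersetCard, (mem_matchings.1 hM').2.1, Nat.choose_succ_self_right]

theorem pow_le_card_matchings_mul_factorial {k D m c : ℕ} (hk : 1 ≤ k) (hE : ∀ e ∈ E, #e = k)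
    (hD : ∀ v, #{e ∈ E | v ∈ e} ≤ D) (hc : c + m * k * D ≤ #E) :
    c ^ m ≤ #(matchings E m) * m.factorial := by
  suffices h : ∀ j ≤ m, c ^ j ≤ #(matchings E j) * j.factorial from h m le_rfl
  intro j
  induction j with
  | zero =>
    intro _
    have : (∅ : Finset (Finset V)) ∈ matchings E 0 := by simp [mem_matchings]
    have := card_pos.2 ⟨_, this⟩
    simpa using this
  | succ j ih =>
    intro hj
    have h1 : j * k * D ≤ m * k * D := by gcongr; omega
    have h2 := card_matchings_succ (j := j) (c := c) hk hE hD (by omega)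
    calc c ^ (j + 1) = c ^ j * c := pow_succ _ _
      _ ≤ #(matchings E j) * j.factorial * c := Nat.mul_le_mul_right _ (ih (by omega))
      _ = #(matchings E j) * c * j.factorial := by ring
      _ ≤ #(matchings E (j + 1)) * (j + 1) * j.factorial := Nat.mul_le_mul_right _ h2
      _ = _ := by rw [Nat.factorial_succ]; ring

theorem pow_le_card_matchings {k D m n : ℕ} (hk : 1 ≤ k) (hm : 1 ≤ m) (hE : ∀ e ∈ E, #e = k)
    (hD : ∀ v, #{e ∈ E | v ∈ e} ≤ D) (hnD : n ≤ D) (hcard : 2 * k * m * D ≤ #E) :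
    (k * n) ^ m ≤ #(matchings E m) := by
  have h1 := pow_le_card_matchings_mul_factorial (m := m) (c := k * m * D) hk hE hD
    (le_trans (by ring_nf; rfl) hcard)
  have h2 : (k * n) ^ m * m ^ m ≤ #(matchings E m) * m ^ m := by
    calc (k * n) ^ m * m ^ m = (k * m * n) ^ m := by rw [← mul_pow]; congr 1; ring
      _ ≤ (k * m * D) ^ m := by gcongr
      _ ≤ _ := h1
      _ ≤ _ := Nat.mul_le_mul_left _ (Nat.factorial_le_pow m)
  exact Nat.le_of_mul_le_mul_right h2 (by positivity)

/-- From `(mk)! ≥ (mk/e)^(mk) ≥ m^(mk)`, where the last step uses `k ≥ 3 > e`. -/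
theorem choose_mul_le_div_pow {n m k : ℕ} (hm : 1 ≤ m) (hk : 3 ≤ k) :
    (n.choose (m * k) : ℝ) ≤ ((n : ℝ) / m) ^ (m * k) := by
  have hm' : (0 : ℝ) < m := by exact_mod_cast hm
  have hk' : (3 : ℝ) ≤ k := by exact_mod_cast hk
  refine (Nat.choose_le_pow_div (m * k) n).trans ?_
  rw [div_pow]
  refine div_le_div_of_nonneg_left (by positivity) (by positivity) ?_
  have h1 := Real.pow_div_factorial_le_exp ((m * k : ℕ) : ℝ) (by positivity) (m * k)
  have h2 : Real.exp ((m * k : ℕ) : ℝ) ≤ (k : ℝ) ^ (m * k) := by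
    rw [← mul_one ((m * k : ℕ) : ℝ), Real.exp_nat_mul]
    refine pow_le_pow_left₀ (Real.exp_pos _).le ?_ _
    have := Real.exp_one_lt_d9
    linarith
  have h3 := h1.trans h2
  rw [div_le_iff₀ (by positivity), Nat.cast_mul, mul_pow, mul_comm] at h3
  exact le_of_mul_le_mul_left h3 (by positivity)

/-! ### From a sunflower of matchings to a regular subgraph. -/

/-- A `k`-uniform hypergraph with bounded degrees and sufficiently many edges contains an `r`-regular
subgraph. -/
theorem exists_regular_of_card_edges [Fintype V] {k r m D : ℕ} (hk : 3 ≤ k) (hr : 1 ≤ r)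
    (hm : 4 * r < m) (hE : ∀ e ∈ E, #e = k) (hD : ∀ v, #{e ∈ E | v ∈ e} ≤ D)
    (hn : 1 ≤ Fintype.card V) (hnD : Fintype.card V ≤ D) (hcard : 2 * k * m * D ≤ #E)
    (hdens : 256 * (r : ℝ) ^ 2 ≤ ((m : ℝ) / Fintype.card V) ^ (k - 1) * Real.log m) :
    ∃ F ⊆ E, ∃ S : Finset V, S.Nonempty ∧ (∀ v ∈ S, #{e ∈ F | v ∈ e} = r) ∧
      ∀ v ∉ S, ∀ e ∈ F, v ∉ e := by
  classical
  set n := Fintype.card V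
  have hm1 : 1 ≤ m := by omega
  have hm0 : (0 : ℝ) < m := by exact_mod_cast hm1
  have hn0 : (0 : ℝ) < n := by exact_mod_cast hn
  set κ : ℝ := m * ((m : ℝ) / n) ^ (k - 1) with hκ
  have hlog : 256 * (r : ℝ) ^ 2 * m ≤ κ * Real.log m := by
    rw [hκ]
    nlinarith [mul_le_mul_of_nonneg_right hdens hm0.le]
  -- Pigeonhole over covered vertex sets: `κ` is chosen so that `(n/m)^(mk) * κ^m = n^m`, strictly
  -- below the `(kn)^m` matchings available.
  obtain ⟨S, hS, hSF⟩ := exists_lt_card_fiber_of_nsmul_lt_card_of_maps_to (M := ℝ)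
    (s := matchings E m) (t := (univ : Finset V).powersetCard (m * k))
    (f := fun M => M.biUnion id) (b := κ ^ m)
    (fun M hM => mem_powersetCard.2 ⟨subset_univ _, card_biUnion_matching hE hM⟩) (by
      rw [nsmul_eq_mul, card_powersetCard, card_univ]
      calc (n.choose (m * k) : ℝ) * κ ^ m ≤ ((n : ℝ) / m) ^ (m * k) * κ ^ m := by
            refine mul_le_mul_of_nonneg_right (choose_mul_le_div_pow hm1 hk) (by positivity)
        _ = (n : ℝ) ^ m := by
            rw [mul_comm m k, pow_mul, ← mul_pow, hκ]
            congr 1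
            obtain ⟨l, rfl⟩ : ∃ l, k = l + 1 := ⟨k - 1, by omega⟩
            have h1 : (n : ℝ) / m * ((m : ℝ) / n) = 1 := by field_simp
            have h2 : (n : ℝ) / m * m = n := by field_simp
            calc _ = ((n : ℝ) / m * (m / n)) ^ l * (n / m * m) := by
                  rw [Nat.add_sub_cancel, mul_pow]; ring
              _ = n := by rw [h1, h2, one_pow, one_mul]
        _ < ((k * n : ℕ) : ℝ) ^ m := by
            refine pow_lt_pow_left₀ ?_ hn0.le (by omega)
            rw [Nat.cast_mul]
            have : (3 : ℝ) ≤ k := by exact_mod_cast hk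
            nlinarith
        _ ≤ _ := by
            exact_mod_cast pow_le_card_matchings (by omega) hm1 hE hD hnD hcard)
  obtain ⟨K, M, hKm, hM, hdisj⟩ := exists_sunflower hr hm hlog
    ({M ∈ matchings E m | M.biUnion id = S})
    (fun M hM => (mem_matchings.1 (mem_filter.1 hM).1).2.1) hSF
  have hMm : ∀ a, M a ∈ matchings E m := fun a => (mem_filter.1 (hM a).1).1
  have hMS : ∀ a, (M a).biUnion id = S := fun a => (mem_filter.1 (hM a).1).2
  have hcov : ∀ a, ∀ v ∈ S, ∃ e ∈ M a, v ∈ e := by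
    intro a v hv
    rw [← hMS a] at hv
    simpa using hv
  have huniq : ∀ a, ∀ e ∈ M a, ∀ f ∈ M a, ∀ v, v ∈ e → v ∈ f → e = f := by
    intro a e he f hf v hve hvf
    by_contra hef
    exact disjoint_left.1 ((mem_matchings.1 (hMm a)).2.2 e he f hf hef) hve hvf
  let a₀ : Fin r := ⟨0, hr⟩
  refine ⟨univ.biUnion fun a => M a \ K, ?_, S \ K.biUnion id, ?_, ?_, ?_⟩
  · exact biUnion_subset.2 fun a _ => sdiff_subset.trans (mem_matchings.1 (hMm a)).1
  -- As `K` has fewer than `m` edges, some edge of the matching is outside `K`; by disjointness its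
  -- vertices avoid all edges of `K`.
  · obtain ⟨e, he, heK⟩ := exists_mem_notMem_of_card_lt_card
      (hKm.trans_eq (mem_matchings.1 (hMm a₀)).2.1.symm)
    have hek := hE e ((mem_matchings.1 (hMm a₀)).1 he)
    obtain ⟨v, hv⟩ := card_pos.1 (by omega : 0 < #e)
    refine ⟨v, mem_sdiff.2 ⟨?_, ?_⟩⟩
    · rw [← hMS a₀]
      exact mem_biUnion.2 ⟨e, he, hv⟩
    · intro hvK
      obtain ⟨f, hf, hvf⟩ := mem_biUnion.1 hvK
      exact heK (huniq a₀ e he f ((hM a₀).2 hf) v hv hvf ▸ hf)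
  · intro v hv
    rw [mem_sdiff] at hv
    choose e he hve using fun a => hcov a v hv.1
    have heK : ∀ a, e a ∉ K := fun a h => hv.2 (mem_biUnion.2 ⟨e a, h, hve a⟩)
    have himg : ({f ∈ univ.biUnion fun a => M a \ K | v ∈ f} : Finset (Finset V)) =
        univ.image e := by
      ext f
      simp only [mem_filter, mem_biUnion, mem_univ, true_and, mem_sdiff, mem_image]
      constructor
      · rintro ⟨⟨a, hf, -⟩, hvf⟩
        exact ⟨a, huniq a _ (he a) _ hf v (hve a) hvf⟩
      · rintro ⟨a, rfl⟩
        exact ⟨⟨a, he a, heK a⟩, hve a⟩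
    -- The edges at `v` from different matchings are distinct because the petals are disjoint, so
    -- the count is exactly `r`.
    rw [himg, card_image_of_injective, card_univ, Fintype.card_fin]
    intro a b hab
    by_contra hne
    exact disjoint_left.1 (hdisj hne) (mem_sdiff.2 ⟨he a, heK a⟩)
      (by rw [hab]; exact mem_sdiff.2 ⟨he b, heK b⟩)
  · intro v hv e he hve
    simp only [mem_biUnion, mem_univ, true_and, mem_sdiff] at he
    obtain ⟨a, hea, heK⟩ := he
    refine hv (mem_sdiff.2 ⟨?_, ?_⟩)
    · rw [← hMS a]
      exact mem_biUnion.2 ⟨e, hea, hve⟩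
    · intro hvK
      obtain ⟨f, hf, hvf⟩ := mem_biUnion.1 hvK
      exact heK (huniq a e hea f ((hM a).2 hf) v hve hvf ▸ hf)

end

/-! ### Passage to finsets and degree bounds. -/

namespace Hypergraph

open Finset Filter

open Classical in
/-- The edges of a hypergraph on a finite type, as finsets. -/
noncomputable def edgeFinsets {V : Type*} [Fintype V] (H : Hypergraph V) : Finset (Finset V) :=
  {e | (e : Set V) ∈ H.edgeSet}

section
variable {V : Type*} [Fintype V] {H : Hypergraph V}

theorem mem_edgeFinsets {e : Finset V} : e ∈ H.edgeFinsets ↔ (e : Set V) ∈ H.edgeSet := by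
  simp [edgeFinsets]

theorem card_edgeFinsets : #H.edgeFinsets = H.edgeSet.ncard := by
  have h : H.edgeSet = (fun e : Finset V => (e : Set V)) '' (H.edgeFinsets : Set (Finset V)) := by
    ext e
    simp only [Set.mem_image, mem_coe, mem_edgeFinsets]
    constructor
    · intro he
      exact ⟨(Set.toFinite e).toFinset, by simpa using he, by simp⟩
    · rintro ⟨f, hf, rfl⟩
      exact hf
  rw [h, Set.ncard_image_of_injective _ Finset.coe_injective, Set.ncard_coe_finset]

theorem UniformOf.card_eq {k : ℕ} (hH : H.UniformOf k) : ∀ e ∈ H.edgeFinsets, #e = k := by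
  intro e he
  have := hH _ (mem_edgeFinsets.1 he)
  rw [Set.encard_coe_eq_coe_finsetCard] at this
  exact_mod_cast this

theorem hasRegularSubgraph_of_finset [DecidableEq V] {r : ℕ} (hV : H.vertexSet = Set.univ)
    (h : ∃ F ⊆ H.edgeFinsets, ∃ S : Finset V, S.Nonempty ∧ (∀ v ∈ S, #{e ∈ F | v ∈ e} = r) ∧
      ∀ v ∉ S, ∀ e ∈ F, v ∉ e) : H.HasRegularSubgraph r := by
  obtain ⟨F, hF, S, hS, hreg, hout⟩ := h
  refine ⟨(fun e : Finset V => (e : Set V)) '' (F : Set (Finset V)), ?_, (S : Set V),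
    by simp [hV], hS, ?_, ?_⟩
  · rintro _ ⟨e, he, rfl⟩
    exact mem_edgeFinsets.1 (hF he)
  · intro v hv
    have himg : {e ∈ (fun e : Finset V => (e : Set V)) '' (F : Set (Finset V)) | v ∈ e} =
        (fun e : Finset V => (e : Set V)) '' (({e ∈ F | v ∈ e} : Finset (Finset V)) : Set _) := by
      ext f
      simp only [Set.mem_ofPred_eq, Set.mem_image, mem_coe, mem_filter]
      constructor
      · rintro ⟨⟨e, he, rfl⟩, hv⟩
        exact ⟨e, ⟨he, hv⟩, rfl⟩
      · rintro ⟨e, ⟨he, hv⟩, rfl⟩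
        exact ⟨⟨e, he, rfl⟩, hv⟩
    rw [himg, Finset.coe_injective.encard_image, Set.encard_coe_eq_coe_finsetCard,
      hreg v hv]
  · rintro v hv _ ⟨e, he, rfl⟩
    exact hout v hv e he

end

/-- An edge through `v` is determined by any `t - 1` of its other vertices, since two distinct edges
share fewer than `t`. -/
theorem card_edges_containing_le {V : Type*} [Fintype V] [DecidableEq V] {E : Finset (Finset V)}
    {t k : ℕ} (ht : 1 ≤ t) (htk : t ≤ k) (hE : ∀ e ∈ E, #e = k)
    (hinter : ∀ e ∈ E, ∀ f ∈ E, e ≠ f → #(e ∩ f) < t) (v : V) :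
    #{e ∈ E | v ∈ e} ≤ Fintype.card V ^ (t - 1) := by
  have hsub : ∀ e ∈ ({e ∈ E | v ∈ e} : Finset (Finset V)), ∃ T ⊆ e.erase v, #T = t - 1 := by
    intro e he
    rw [mem_filter] at he
    refine exists_subset_card_eq ?_
    rw [card_erase_of_mem he.2, hE e he.1]
    omega
  choose! g hg hgcard using hsub
  calc #{e ∈ E | v ∈ e} ≤ #((univ : Finset V).powersetCard (t - 1)) := by
        refine card_le_card_of_injOn g
          (fun e he => mem_powersetCard.2 ⟨subset_univ _, hgcard e he⟩) ?_
        intro e he f hf hef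
        by_contra hne
        have he' := mem_filter.1 (mem_coe.1 he)
        have hf' := mem_filter.1 (mem_coe.1 hf)
        have h1 : insert v (g e) ⊆ e ∩ f := by
          refine insert_subset (mem_inter.2 ⟨he'.2, hf'.2⟩) (subset_inter ?_ ?_)
          · exact (hg e he).trans (erase_subset _ _)
          · rw [show g e = g f from hef]
            exact (hg f hf).trans (erase_subset _ _)
        have h2 : v ∉ g e := fun h => notMem_erase v e (hg e he h)
        have h3 := card_le_card h1
        rw [card_insert_of_notMem h2, hgcard e he] at h3
        have := hinter e he'.1 f hf'.1 hne
        omega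
    _ ≤ _ := by
        rw [card_powersetCard, card_univ]
        exact Nat.choose_le_pow _ _

/-- A criterion for regular subgraphs in partial Steiner systems. -/
theorem hasRegularSubgraph_of_inter_lt {n t k r m : ℕ} (H : Hypergraph (Fin n))
    (hV : H.vertexSet = Set.univ) (hU : H.UniformOf k) (hk : 3 ≤ k) (hr : 1 ≤ r) (ht : 2 ≤ t)
    (htk : t ≤ k) (hinter : ∀ e ∈ H.edgeFinsets, ∀ f ∈ H.edgeFinsets, e ≠ f → #(e ∩ f) < t)
    (hn : 1 ≤ n) (hm : 4 * r < m) (hcard : 2 * k * m * n ^ (t - 1) ≤ #H.edgeFinsets)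
    (hdens : 256 * (r : ℝ) ^ 2 ≤ ((m : ℝ) / n) ^ (k - 1) * Real.log m) :
    H.HasRegularSubgraph r := by
  refine hasRegularSubgraph_of_finset hV (exists_regular_of_card_edges (m := m)
    (D := n ^ (t - 1)) hk hr hm hU.card_eq ?_ ?_ ?_ hcard ?_)
  · intro v
    simpa using card_edges_containing_le (by omega) htk hU.card_eq hinter v
  · simpa using hn
  · rw [Fintype.card_fin]
    exact Nat.le_self_pow (by omega) n
  · rwa [Fintype.card_fin]

theorem Linear.card_inter_lt {V : Type*} [Fintype V] [DecidableEq V] {H : Hypergraph V}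
    (hH : H.Linear) : ∀ e ∈ H.edgeFinsets, ∀ f ∈ H.edgeFinsets, e ≠ f → #(e ∩ f) < 2 := by
  intro e he f hf hef
  have h1 := hH _ (mem_edgeFinsets.1 he) _ (mem_edgeFinsets.1 hf)
    (fun h => hef (Finset.coe_injective h))
  rw [← coe_inter, Set.encard_coe_eq_coe_finsetCard] at h1
  have h2 : #(e ∩ f) ≤ 1 := by exact_mod_cast h1
  omega

/-! ### Asymptotics for linear hypergraphs. -/

theorem eventually_mul_sqrt_loglog_le (C : ℝ) : ∀ᶠ n : ℕ in atTop,
    1 ≤ Real.logb 2 (Real.logb 2 (n : ℝ)) ∧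
      C * √(Real.logb 2 (Real.logb 2 (n : ℝ))) ≤ Real.log n := by
  have hlog2 : 0 < Real.log 2 := Real.log_pos (by norm_num)
  have htend : Tendsto (fun n : ℕ => Real.logb 2 (n : ℝ)) atTop atTop :=
    (Real.tendsto_logb_atTop (by norm_num)).comp tendsto_natCast_atTop_atTop
  refine htend.eventually (p := fun y => 1 ≤ Real.logb 2 y ∧
    C * √(Real.logb 2 y) ≤ y * Real.log 2) ?_ |>.mono fun n hn => ?_
  · have h1 := (Real.tendsto_logb_atTop (b := 2) (by norm_num)).eventually_ge_atTop 1
    have h2 := Real.isLittleO_log_id_atTop.bound hlog2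
    have h3 := Real.tendsto_sqrt_atTop.eventually_ge_atTop (|C| / Real.log 2)
    filter_upwards [h1, h2, h3, eventually_ge_atTop (1 : ℝ)] with y h1 h2 h3 hy
    refine ⟨h1, ?_⟩
    have h4 : Real.logb 2 y ≤ y := by
      rw [Real.logb, div_le_iff₀ hlog2]
      simp only [Real.norm_eq_abs, id] at h2
      rw [abs_of_nonneg (show (0 : ℝ) ≤ y by linarith)] at h2
      linarith [le_abs_self (Real.log y)]
    rw [div_le_iff₀ hlog2] at h3
    have h5 := Real.mul_self_sqrt (show (0 : ℝ) ≤ y by linarith)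
    calc C * √(Real.logb 2 y) ≤ |C| * √y :=
          mul_le_mul (le_abs_self C) (Real.sqrt_le_sqrt h4) (Real.sqrt_nonneg _) (abs_nonneg _)
      _ ≤ √y * Real.log 2 * √y := mul_le_mul_of_nonneg_right h3 (Real.sqrt_nonneg _)
      _ = y * Real.log 2 := by rw [mul_right_comm, h5]
  · refine ⟨hn.1, hn.2.trans (le_of_eq ?_)⟩
    rw [Real.logb, div_mul_cancel₀ _ hlog2.ne']

theorem maxLinearRegularFree_lt (k r : ℕ) (hk : 3 ≤ k) (hr : 1 ≤ r) :
    ∀ᶠ n : ℕ in atTop, (maxLinearRegularFree k r n : ℝ) <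
      6 * (n : ℝ) ^ 2 *
        (Real.logb 2 (Real.logb 2 (n : ℝ))) ^ (-(1 / (2 * ((k : ℝ) - 1)))) := by
  have hk' : (3 : ℝ) ≤ k := by exact_mod_cast hk
  -- The first summand gives `√n ≤ n * x / k`, hence `log m ≥ (log n) / 2`; the second gives the
  -- density condition.
  set C : ℝ := 2 * k + 512 * (r : ℝ) ^ 2 * (k : ℝ) ^ (k - 1) with hC
  have hsqrt := (Real.tendsto_sqrt_atTop.comp
    tendsto_natCast_atTop_atTop).eventually_gt_atTop (4 * (r : ℝ))
  filter_upwards [eventually_mul_sqrt_loglog_le C, hsqrt, eventually_ge_atTop 1]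
    with n hn hrn hn1
  obtain ⟨hL1, hCL⟩ := hn
  simp only [Function.comp] at hrn
  set L : ℝ := Real.logb 2 (Real.logb 2 (n : ℝ)) with hL
  have hn0 : (1 : ℝ) ≤ n := by exact_mod_cast hn1
  set x : ℝ := L ^ (-(1 / (2 * ((k : ℝ) - 1)))) with hx
  have hx0 : 0 < x := Real.rpow_pos_of_pos (by linarith) _
  have hsL : 0 < √L := Real.sqrt_pos.2 (by linarith)
  have hsn : 0 < √(n : ℝ) := Real.sqrt_pos.2 (by linarith)
  have hsn2 : √(n : ℝ) * √n = n := Real.mul_self_sqrt (by linarith)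
  have hinv : (√L)⁻¹ = L ^ (-(1 / 2) : ℝ) := by
    rw [Real.rpow_neg (by linarith), Real.sqrt_eq_rpow]
  have hxL : (√L)⁻¹ ≤ x := by
    rw [hinv]
    refine Real.rpow_le_rpow_of_exponent_le hL1 (neg_le_neg ?_)
    refine one_div_le_one_div_of_le (by norm_num) ?_
    linarith
  have hxpow : x ^ (k - 1) = (√L)⁻¹ := by
    rw [hinv, hx, ← Real.rpow_natCast, ← Real.rpow_mul (by linarith)]
    congr 1
    rw [Nat.cast_sub (by omega), Nat.cast_one]
    have : (k : ℝ) - 1 ≠ 0 := by linarith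
    field_simp
  have hlog_sqrt : Real.log n = 2 * Real.log √n := by
    rw [Real.log_sqrt (by linarith)]
    ring
  have hkL : k * √L ≤ √n := by
    have h1 := Real.log_le_sub_one_of_pos hsn
    have h2 : 2 * k * √L ≤ C * √L := by
      refine mul_le_mul_of_nonneg_right ?_ hsL.le
      rw [hC]
      have : 0 ≤ 512 * (r : ℝ) ^ 2 * (k : ℝ) ^ (k - 1) := by positivity
      linarith
    linarith
  have hnx : √n ≤ n * x / k := by
    rw [le_div_iff₀ (by linarith)]
    have h1 : k ≤ √n * x := by
      calc (k : ℝ) = k * √L * (√L)⁻¹ := by field_simp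
        _ ≤ √n * x := mul_le_mul hkL hxL (by positivity) hsn.le
    nlinarith
  have hr' : (1 : ℝ) ≤ r := by exact_mod_cast hr
  -- The largest `m` for which `2kmn` is at most the assumed `6n²x` edges. The factor 3 leaves room
  -- for the floor, so that `m ≥ n * x / k`.
  set m := ⌊3 * n * x / k⌋₊ with hm
  have hm_le : (m : ℝ) ≤ 3 * n * x / k := Nat.floor_le (by positivity)
  have hm_ge : n * x / k ≤ m := by
    have h1 : 3 * n * x / k < m + 1 := Nat.lt_floor_add_one _
    have h2 : 3 * n * x / k = 3 * (n * x / k) := by ring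
    linarith
  obtain ⟨H, hV, hU, hlin, hfree, hmax⟩ := (isGreatest_maxLinearRegularFree k n hr).1
  by_contra hcon
  rw [not_lt, ← hmax, ← card_edgeFinsets] at hcon
  refine hfree (hasRegularSubgraph_of_inter_lt (t := 2) (m := m) H hV hU hk hr le_rfl (by omega)
    hlin.card_inter_lt hn1 ?_ ?_ ?_)
  · have : 4 * (r : ℝ) < m := by linarith
    exact_mod_cast this
  · have h1 : (2 * k * m * n ^ (2 - 1) : ℝ) ≤ #H.edgeFinsets := by
      refine le_trans ?_ hcon
      calc (2 * k * m * n ^ (2 - 1) : ℝ) ≤ 2 * k * (3 * n * x / k) * n ^ (2 - 1) := by gcongr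
        _ = _ := by
          rw [show 2 - 1 = 1 from rfl]
          field_simp
          ring
    exact_mod_cast h1
  · have h1 : x / k ≤ (m : ℝ) / n := by
      rw [le_div_iff₀ (by linarith)]
      calc x / k * n = n * x / k := by ring
        _ ≤ _ := hm_ge
    have h2 : Real.log n / 2 ≤ Real.log m := by
      have := Real.log_le_log hsn (hnx.trans hm_ge)
      linarith
    have h3 : 0 ≤ Real.log n := Real.log_nonneg hn0
    have h4 : 512 * (r : ℝ) ^ 2 * (k : ℝ) ^ (k - 1) * √L ≤ Real.log n := by
      refine le_trans (mul_le_mul_of_nonneg_right ?_ hsL.le) hCL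
      rw [hC]
      linarith
    calc 256 * (r : ℝ) ^ 2 =
          (√L)⁻¹ / (k : ℝ) ^ (k - 1) *
            (512 * (r : ℝ) ^ 2 * (k : ℝ) ^ (k - 1) * √L / 2) := by
          field_simp
          norm_num
      _ ≤ (√L)⁻¹ / (k : ℝ) ^ (k - 1) * (Real.log n / 2) := by gcongr
      _ = (x / k) ^ (k - 1) * (Real.log n / 2) := by rw [div_pow, hxpow]
      _ ≤ _ := by gcongr

/-! ### Steiner systems. -/

theorem IsSteinerSystem.card_inter_lt {V : Type*} [Fintype V] [DecidableEq V]
    {H : Hypergraph V} {t k : ℕ} (hV : H.vertexSet = Set.univ) (hH : H.IsSteinerSystem t k) :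
    ∀ e ∈ H.edgeFinsets, ∀ f ∈ H.edgeFinsets, e ≠ f → #(e ∩ f) < t := by
  intro e he f hf hef
  by_contra hcon
  obtain ⟨T, hT, hTt⟩ := exists_subset_card_eq (not_lt.1 hcon)
  refine hef (Finset.coe_injective ((hH.2 (T : Set V) (by simp [hV])
    (by rw [Set.encard_coe_eq_coe_finsetCard, hTt])).unique ⟨mem_edgeFinsets.1 he, ?_⟩
      ⟨mem_edgeFinsets.1 hf, ?_⟩))
  · exact_mod_cast hT.trans inter_subset_left
  · exact_mod_cast hT.trans inter_subset_right

theorem IsSteinerSystem.choose_le {V : Type*} [Fintype V]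
    {H : Hypergraph V} {t k : ℕ} (hV : H.vertexSet = Set.univ) (hH : H.IsSteinerSystem t k) :
    (Fintype.card V).choose t ≤ #H.edgeFinsets * k.choose t := by
  classical
  have hsub : (univ : Finset V).powersetCard t ⊆
      H.edgeFinsets.biUnion fun e => e.powersetCard t := by
    intro T hT
    have hTt := (mem_powersetCard.1 hT).2
    obtain ⟨e, ⟨he, hTe⟩, -⟩ := hH.2 (T : Set V) (by simp [hV])
      (by rw [Set.encard_coe_eq_coe_finsetCard, hTt])
    refine mem_biUnion.2 ⟨(Set.toFinite e).toFinset, mem_edgeFinsets.2 (by simpa using he),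
      mem_powersetCard.2 ⟨?_, hTt⟩⟩
    intro v hv
    simpa using hTe hv
  have h := card_le_card hsub
  rw [card_powersetCard, card_univ] at h
  exact h.trans (card_biUnion_le_card_mul _ _ _ fun e he => by
    rw [card_powersetCard, hH.1.card_eq e he])

theorem eventually_isSteinerSystem_hasRegularSubgraph (t k r : ℕ) (ht : 2 ≤ t) (htk : t < k)
    (hr : 1 ≤ r) : ∀ᶠ n : ℕ in atTop, ∀ H : Hypergraph (Fin n), H.vertexSet = Set.univ →
      H.IsSteinerSystem t k → H.HasRegularSubgraph r := by
  -- Chosen so that `n ^ t ≤ c * #H.edgeFinsets` once `n ≥ 2 * t`. Then `m = n / (2 * k * c)` meets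
  -- the edge condition, `m / n` is bounded below, and `log m → ∞` supplies the density.
  set c : ℕ := 2 ^ t * t.factorial * k.choose t with hc
  have hc0 : 0 < c := by
    have := Nat.choose_pos htk.le
    positivity
  have hd0 : 0 < 2 * k * c := Nat.mul_pos (by omega) hc0
  have hm : Tendsto (fun n : ℕ => n / (2 * k * c)) atTop atTop :=
    Nat.tendsto_div_const_atTop hd0.ne'
  have hlog := (Real.tendsto_log_atTop.comp (tendsto_natCast_atTop_atTop.comp hm)).eventually_ge_atTop
    (256 * (r : ℝ) ^ 2 * ((2 * (2 * k * c) : ℕ) : ℝ) ^ (k - 1))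
  filter_upwards [hlog, hm.eventually_gt_atTop (4 * r), eventually_ge_atTop (2 * t)]
    with n hlog hm hnt H hV hH
  set m := n / (2 * k * c) with hmdef
  simp only [Function.comp] at hlog
  have hn1 : 1 ≤ n := by omega
  refine hasRegularSubgraph_of_inter_lt (m := m) H hV hH.1 (by omega) hr ht htk.le
    (hH.card_inter_lt hV) hn1 hm ?_ ?_
  · have h1 : n ^ t ≤ c * #H.edgeFinsets := by
      have h2 := hH.choose_le hV
      rw [Fintype.card_fin] at h2
      have h3 : (n + 1 - t) ^ t ≤ t.factorial * n.choose t := by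
        have h := Nat.pow_le_choose (α := ℚ) t n
        rw [div_le_iff₀ (by positivity)] at h
        rw [mul_comm]
        exact_mod_cast h
      calc n ^ t ≤ (2 * (n + 1 - t)) ^ t := Nat.pow_le_pow_left (by omega) t
        _ = 2 ^ t * (n + 1 - t) ^ t := mul_pow _ _ _
        _ ≤ 2 ^ t * (t.factorial * (#H.edgeFinsets * k.choose t)) := by gcongr; exact h3.trans (by gcongr)
        _ = _ := by rw [hc]; ring
    have h2 : m * (2 * k * c) ≤ n := Nat.div_mul_le_self _ _
    refine Nat.le_of_mul_le_mul_left ?_ hc0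
    refine le_trans ?_ h1
    obtain ⟨l, rfl⟩ : ∃ l, t = l + 1 := ⟨t - 1, by omega⟩
    calc c * (2 * k * m * n ^ (l + 1 - 1)) = m * (2 * k * c) * n ^ l := by
          rw [Nat.add_sub_cancel]; ring
      _ ≤ n * n ^ l := Nat.mul_le_mul_right _ h2
      _ = _ := by ring
  · have h1 : n ≤ m * (2 * (2 * k * c)) := by
      have h2 : n < (2 * k * c) * (m + 1) := Nat.lt_mul_div_succ n hd0
      have h3 : 1 ≤ m := by omega
      nlinarith
    have h2 : (((2 * (2 * k * c) : ℕ) : ℝ))⁻¹ ≤ (m : ℝ) / n := by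
      have hn0 : (0 : ℝ) < n := by exact_mod_cast hn1
      have hd0' : (0 : ℝ) < ((2 * (2 * k * c) : ℕ) : ℝ) := by exact_mod_cast (by omega)
      rw [inv_eq_one_div, div_le_div_iff₀ hd0' hn0, one_mul]
      exact_mod_cast h1
    have hd0' : (0 : ℝ) < ((2 * (2 * k * c) : ℕ) : ℝ) := by exact_mod_cast (by omega)
    have hm0 : (0 : ℝ) ≤ Real.log m := Real.log_natCast_nonneg m
    calc 256 * (r : ℝ) ^ 2 = (((2 * (2 * k * c) : ℕ) : ℝ))⁻¹ ^ (k - 1) *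
          (256 * (r : ℝ) ^ 2 * ((2 * (2 * k * c) : ℕ) : ℝ) ^ (k - 1)) := by
          rw [inv_pow]
          field_simp
      _ ≤ _ := by gcongr

theorem maxLinearRegularFree_isLittleO (k r : ℕ) (hk : 3 ≤ k) (hr : 1 ≤ r) :
    (fun n : ℕ => (maxLinearRegularFree k r n : ℝ)) =o[atTop] (fun n : ℕ => (n : ℝ) ^ 2) := by
  have hk' : (3 : ℝ) ≤ k := by exact_mod_cast hk
  have hexp : 0 < 1 / (2 * ((k : ℝ) - 1)) := one_div_pos.2 (by linarith)
  have hL : Tendsto (fun n : ℕ => Real.logb 2 (Real.logb 2 (n : ℝ))) atTop atTop :=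
    (Real.tendsto_logb_atTop (by norm_num)).comp
      ((Real.tendsto_logb_atTop (by norm_num)).comp tendsto_natCast_atTop_atTop)
  rw [Asymptotics.isLittleO_iff]
  intro c hc
  filter_upwards [maxLinearRegularFree_lt k r hk hr,
    ((tendsto_rpow_neg_atTop hexp).comp hL).eventually_le_const (show 0 < c / 6 by positivity)]
    with n h1 h2
  simp only [Function.comp] at h2
  rw [Real.norm_of_nonneg (by positivity), Real.norm_of_nonneg (by positivity)]
  nlinarith [mul_le_mul_of_nonneg_left h2 (sq_nonneg (n : ℝ))]

end Hypergraph

theorem corollary5 :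
    (∀ k r : ℕ, 3 ≤ k → 3 ≤ r → ∃ N : ℕ, ∀ n : ℕ, N ≤ n →
      (Hypergraph.maxLinearRegularFree k r n : ℝ) <
        6 * (n : ℝ) ^ 2 *
          (Real.logb 2 (Real.logb 2 (n : ℝ))) ^ (-(1 / (2 * ((k : ℝ) - 1))))) ∧
    ((fun n : ℕ => (Hypergraph.maxLinearRegularFree 3 3 n : ℝ))
      =o[Filter.atTop] (fun n : ℕ => (n : ℝ) ^ 2)) ∧
    (∀ t k r : ℕ, 2 ≤ t → t < k → 1 ≤ r → ∃ N : ℕ, ∀ n : ℕ, N ≤ n →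
      ∀ H : Hypergraph (Fin n), H.vertexSet = Set.univ → H.IsSteinerSystem t k →
        H.HasRegularSubgraph r) := by
  refine ⟨fun k r hk hr => ?_, Hypergraph.maxLinearRegularFree_isLittleO 3 3 le_rfl (by norm_num),
    fun t k r ht htk hr => ?_⟩
  · exact Filter.eventually_atTop.1 (Hypergraph.maxLinearRegularFree_lt k r hk (by omega))
  · exact Filter.eventually_atTop.1
      (Hypergraph.eventually_isSteinerSystem_hasRegularSubgraph t k r ht htk hr)
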